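/- Let $(\Omega,\mathcal F,P)$ be a probability space and let $\sigma\colon[0,1)\to[0,\infty)$ be a distortion, i.e. a nonnegative, nondecreasing function with $\int_0^1\sigma(u)\,du=1$ ($\sigma$ may be unbounded near $1$; a value at $u=1$ plays no role). For a random variable $L$ with distribution function $F_L(x)=P(L\le x)$ and quantile function $F_L^{-1}(u)=\inf\{x: F_L(x)\ge u\}$ put $$\pi_\sigma(L)=\int_0^1F_L^{-1}(u)\,\sigma(u)\,du .$$ For $h\colon\mathbb R\to\mathbb R$ let $h^*(y)=\sup_{x\in\mathbb R}\,(xy-h(x))\in(-\infty,\infty]$ be its convex conjugate. Then for every $L\in L^\infty(P)$ $$\pi_\sigma(L)=\inf_{h\text{ measurable}}\Big\{\mathbb E\,h(L)+\int_0^1h^*(\sigma(p))\,dp\Big\}=\inf_{h\text{ convex}}\Big\{\mathbb E\,h(L)+\int_0^1h^*(\sigma(p))\,dp\Big\}$$ and $$\pi_\sigma(L)=\inf\Big\{\mathbb E\,h(L)\;:\;h\text{ measurable},\ \int_0^1h^*(\sigma(p))\,dp\le 0\Big\}.$$ The infima range over the Borel measurable, respectively the convex, functions $h\colon\mathbb R\to\mathbb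 R$; they are taken in $[-\infty,\infty]$. The integral $\int_0^1h^*(\sigma(p))\,dp$ always exists in $(-\infty,\infty]$, because $h^*\ge-h(0)$ on the range of $\sigma$; if it equals $+\infty$, the sum $\mathbb E\,h(L)+\int_0^1h^*(\sigma(p))\,dp$ is read as $+\infty$, and if it is finite, then $\mathbb E\,h(L)$ exists in $(-\infty,\infty]$. -/

import Mathlib

open MeasureTheory

noncomputable section

namespace DistortedPremium

/-- A distortion: a nonnegative, nondecreasing density on the unit interval. The value at the right
endpoint plays no role, so that distortions which are unbounded near `1` are allowed as well.
(The last field entails integrability, as a non-integrable function has Bochner integral `0`.) -/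
structure IsDistortion (σ : ℝ → ℝ) : Prop where
  nonneg : ∀ u ∈ Set.Ico (0 : ℝ) 1, 0 ≤ σ u
  mono : MonotoneOn σ (Set.Ico (0 : ℝ) 1)
  integral_eq_one : ∫ u in (0 : ℝ)..1, σ u = 1

/-- The generalized inverse `F_L⁻¹(u) = inf {x : F_L(x) ≥ u}` of the distribution function of the
random variable `L` under `P`. -/
def quantile {Ω : Type*} [MeasurableSpace Ω] (P : Measure Ω) (L : Ω → ℝ) (u : ℝ) : ℝ :=
  sInf {x : ℝ | u ≤ ProbabilityTheory.cdf (P.map L) x}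

/-- The distorted premium `π_σ(L) = ∫₀¹ F_L⁻¹(u) σ(u) du`. -/
def premium {Ω : Type*} [MeasurableSpace Ω] (P : Measure Ω) (σ : ℝ → ℝ) (L : Ω → ℝ) : ℝ :=
  ∫ u in (0 : ℝ)..1, quantile P L u * σ u

/-- The convex conjugate `h*(y) = sup_x (x y - h(x))`, which may take the value `+∞`. -/
def conjugate (h : ℝ → ℝ) (y : ℝ) : EReal :=
  ⨆ x : ℝ, ((x * y - h x : ℝ) : EReal)

/-- The integral of an extended real valued function, `∫ f⁺ - ∫ f⁻`, set to `+∞` whenever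
`∫ f⁺ = +∞`. -/
def extIntegral {α : Type*} [MeasurableSpace α] (μ : Measure α) (f : α → EReal) : EReal :=
  open Classical in
  if ∫⁻ x, (f x).toENNReal ∂μ = ⊤ then ⊤
  else ((∫⁻ x, (f x).toENNReal ∂μ : ENNReal) : EReal)
    - ((∫⁻ x, (-f x).toENNReal ∂μ : ENNReal) : EReal)

/-- `E h(L)`, as an extended real number. -/
def expect {Ω : Type*} [MeasurableSpace Ω] (P : Measure Ω) (h : ℝ → ℝ) (L : Ω → ℝ) : EReal :=
  extIntegral P (fun ω => ((h (L ω) : ℝ) : EReal))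

/-- `∫₀¹ h*(σ(p)) dp`, as an extended real number. The integrand is bounded below by `-h(0)`. -/
def conjugateIntegral (h σ : ℝ → ℝ) : EReal :=
  extIntegral (volume.restrict (Set.Ioc (0 : ℝ) 1)) (fun p => conjugate h (σ p))

/-- `E h(L) + ∫₀¹ h*(σ(p)) dp`, read as `+∞` if the second summand is `+∞`. (If the second
summand is finite, then `h(L)` is essentially bounded below for essentially bounded `L`, so that
this is the only place where `∞ - ∞` could occur.) -/
def objective {Ω : Type*} [MeasurableSpace Ω] (P : Measure Ω) (σ : ℝ → ℝ) (L : Ω → ℝ)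
    (h : ℝ → ℝ) : EReal :=
  open Classical in
  if conjugateIntegral h σ = ⊤ then ⊤ else expect P h L + conjugateIntegral h σ

end DistortedPremium

end

open MeasureTheory Set Filter Topology

namespace DistortedPremium

/-! ### The extended integral -/

section ExtIntegral

variable {α : Type*} [MeasurableSpace α] {μ : Measure α}

/-! Write q for the quantile function of L. Under Lebesgue measure on (0, 1), q has the law of L
(`map_quantile`), so E h(L) = ∫ h(q). Integrating the Fenchel–Young inequality q σ ≤ h(q) + h*(σ)
bounds every objective below by the premium (`premium_le_objective`).

Near-equality holds because q and σ are both nondecreasing: the points (σ(u), q(u)) lie on a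
monotone graph, hence on the subdifferential of a potential k (`exists_subgradient_potential`), and
h = k* would be optimal. But k grows only linearly, so k* may be infinite. Adding a superlinear Θ
with ∫ Θ(σ) ≤ ε (`exists_superlinear`) makes the conjugate finite at a cost of ε, and subtracting a
constant normalizes the conjugate integral to be at most 0. The resulting h is convex, measurable
and feasible for the constraint, so it serves all three infima. -/

theorem extIntegral_mono {f g : α → EReal} (hfg : ∀ᵐ x ∂μ, f x ≤ g x) :
    extIntegral μ f ≤ extIntegral μ g := by
  have h1 : ∫⁻ x, (f x).toENNReal ∂μ ≤ ∫⁻ x, (g x).toENNReal ∂μ :=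
    lintegral_mono_ae (hfg.mono fun x hx => EReal.toENNReal_le_toENNReal hx)
  have h2 : ∫⁻ x, (-g x).toENNReal ∂μ ≤ ∫⁻ x, (-f x).toENNReal ∂μ :=
    lintegral_mono_ae (hfg.mono fun x hx =>
      EReal.toENNReal_le_toENNReal (EReal.neg_le_neg_iff.2 hx))
  unfold extIntegral
  by_cases hg : ∫⁻ x, (g x).toENNReal ∂μ = ⊤
  · rw [if_pos hg]; exact le_top
  · have hf : ∫⁻ x, (f x).toENNReal ∂μ ≠ ⊤ := fun hf => hg (top_le_iff.1 (hf.symm.le.trans h1))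
    rw [if_neg hg, if_neg hf]
    exact EReal.sub_le_sub (EReal.coe_ennreal_le_coe_ennreal_iff.2 h1)
      (EReal.coe_ennreal_le_coe_ennreal_iff.2 h2)

theorem extIntegral_coe {f : α → ℝ} (hf : Integrable f μ) :
    extIntegral μ (fun x => (f x : EReal)) = ((∫ x, f x ∂μ : ℝ) : EReal) := by
  have h1 : ∫⁻ x, ENNReal.ofReal (f x) ∂μ ≠ ⊤ := hf.lintegral_lt_top.ne
  have h2 : ∫⁻ x, ENNReal.ofReal (-f x) ∂μ ≠ ⊤ := hf.neg.lintegral_lt_top.ne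
  have e1 : ∀ x, ((f x : ℝ) : EReal).toENNReal = ENNReal.ofReal (f x) := fun x =>
    EReal.toENNReal_of_ne_top (EReal.coe_ne_top _)
  have e2 : ∀ x, (-((f x : ℝ) : EReal)).toENNReal = ENNReal.ofReal (-f x) := fun x => by
    rw [← EReal.coe_neg]; exact EReal.toENNReal_of_ne_top (EReal.coe_ne_top _)
  unfold extIntegral
  simp only [e1, e2]
  rw [if_neg h1, integral_eq_lintegral_pos_part_sub_lintegral_neg_part hf, EReal.coe_sub,
    EReal.coe_ennreal_toReal h1, EReal.coe_ennreal_toReal h2]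

theorem extIntegral_coe_eq_top {f : α → ℝ} (hf : ∫⁻ x, ENNReal.ofReal (f x) ∂μ = ⊤) :
    extIntegral μ (fun x => (f x : EReal)) = ⊤ := by
  have e1 : ∀ x, ((f x : ℝ) : EReal).toENNReal = ENNReal.ofReal (f x) := fun x =>
    EReal.toENNReal_of_ne_top (EReal.coe_ne_top _)
  unfold extIntegral
  simp only [e1]
  exact if_pos hf

theorem extIntegral_map {β : Type*} [MeasurableSpace β] {g : α → β} (hg : AEMeasurable g μ)
    {f : β → EReal} (hf : Measurable f) :
    extIntegral (μ.map g) f = extIntegral μ (fun x => f (g x)) := by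
  have hf' : Measurable fun x => -f x := hf.neg
  unfold extIntegral
  rw [lintegral_map' hf.ereal_toENNReal.aemeasurable hg,
    lintegral_map' hf'.ereal_toENNReal.aemeasurable hg]

end ExtIntegral

theorem conjugate_le_iff {h : ℝ → ℝ} {y : ℝ} {c : ℝ} :
    conjugate h y ≤ c ↔ ∀ x, x * y - h x ≤ c := by
  simp only [conjugate, iSup_le_iff, EReal.coe_le_coe_iff]

theorem le_conjugate (h : ℝ → ℝ) (x y : ℝ) : ((x * y - h x : ℝ) : EReal) ≤ conjugate h y :=
  le_iSup (fun x : ℝ => ((x * y - h x : ℝ) : EReal)) x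

/-- The endpoints must go: at 0 the quantile is `sInf univ`, a default value, and σ is not
controlled at 1. -/
theorem restrict_Ioc_eq_restrict_Ioo :
    (volume.restrict (Ioc (0 : ℝ) 1)) = volume.restrict (Ioo (0 : ℝ) 1) :=
  Measure.restrict_congr_set Ioo_ae_eq_Ioc.symm

instance isProbabilityMeasure_restrict_Ioo :
    IsProbabilityMeasure (volume.restrict (Ioo (0 : ℝ) 1)) :=
  ⟨by simp⟩

theorem ae_Ioo_of_forall {p : ℝ → Prop} (hp : ∀ u ∈ Ioo (0 : ℝ) 1, p u) :
    ∀ᵐ u ∂(volume.restrict (Ioo (0 : ℝ) 1)), p u :=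
  (ae_restrict_mem measurableSet_Ioo).mono hp

/-! ### Distortions -/

namespace IsDistortion

variable {σ : ℝ → ℝ}

theorem aemeasurable (hσ : IsDistortion σ) :
    AEMeasurable σ (volume.restrict (Ioo (0 : ℝ) 1)) :=
  aemeasurable_restrict_of_monotoneOn measurableSet_Ioo (hσ.mono.mono Ioo_subset_Ico_self)

theorem integrable (hσ : IsDistortion σ) :
    Integrable σ (volume.restrict (Ioo (0 : ℝ) 1)) := by
  have h : IntervalIntegrable σ volume 0 1 := by
    by_contra h
    have := hσ.integral_eq_one
    rw [intervalIntegral.integral_undef h] at this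
    exact zero_ne_one this
  rw [intervalIntegrable_iff_integrableOn_Ioo_of_le zero_le_one] at h
  exact h

theorem nonneg_of_mem_Ioo (hσ : IsDistortion σ) {u : ℝ} (hu : u ∈ Ioo (0 : ℝ) 1) : 0 ≤ σ u :=
  hσ.nonneg u (Ioo_subset_Ico_self hu)

end IsDistortion

/-! ### Quantiles -/

section Quantile

open ProbabilityTheory

variable {Ω : Type*} [MeasurableSpace Ω] {P : Measure Ω} [IsProbabilityMeasure P] {L : Ω → ℝ}

theorem nonempty_le_cdf (ν : Measure ℝ) [IsProbabilityMeasure ν] {u : ℝ} (hu : u < 1) :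
    {x : ℝ | u ≤ cdf ν x}.Nonempty := by
  obtain ⟨x, hx⟩ := ((tendsto_cdf_atTop ν).eventually (lt_mem_nhds hu)).exists
  exact ⟨x, hx.le⟩

theorem bddBelow_le_cdf (ν : Measure ℝ) [IsProbabilityMeasure ν] {u : ℝ} (hu : 0 < u) :
    BddBelow {x : ℝ | u ≤ cdf ν x} := by
  obtain ⟨x, hx⟩ := ((tendsto_cdf_atBot ν).eventually (gt_mem_nhds hu)).exists
  refine ⟨x, fun y hy => ?_⟩
  by_contra! hxy
  exact absurd (hy.trans (monotone_cdf ν hxy.le)) (not_le.2 hx)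

theorem isClosed_le_cdf (ν : Measure ℝ) (u : ℝ) : IsClosed {x : ℝ | u ≤ cdf ν x} := by
  rw [← isOpen_compl_iff, isOpen_iff_mem_nhds]
  intro x hx
  have hx' : cdf ν x < u := not_le.1 hx
  have hr : ∀ᶠ y in 𝓝[≥] x, cdf ν y < u :=
    ((cdf ν).right_continuous x).eventually (gt_mem_nhds hx')
  have hl : ∀ᶠ y in 𝓝[≤] x, cdf ν y < u :=
    eventually_nhdsWithin_of_forall fun y hy => (monotone_cdf ν hy).trans_lt hx'
  have h := eventually_sup.2 ⟨hl, hr⟩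
  rw [nhdsLE_sup_nhdsGE] at h
  exact h.mono fun y hy => not_le.2 hy

/-- Right-continuity makes the superlevel set of the distribution function closed, so its infimum is
attained. -/
theorem quantile_le_iff (hL : AEMeasurable L P) {u : ℝ} (hu : u ∈ Ioo (0 : ℝ) 1) (x : ℝ) :
    quantile P L u ≤ x ↔ u ≤ cdf (P.map L) x := by
  have := Measure.isProbabilityMeasure_map hL
  have hb := bddBelow_le_cdf (P.map L) hu.1
  refine ⟨fun h => ?_, fun h => csInf_le hb h⟩
  exact ((isClosed_le_cdf (P.map L) u).csInf_mem (nonempty_le_cdf _ hu.2) hb).trans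
    (monotone_cdf _ h)

theorem monotoneOn_quantile (hL : AEMeasurable L P) :
    MonotoneOn (quantile P L) (Ioo (0 : ℝ) 1) := fun _ hu _ hv huv =>
  (quantile_le_iff hL hu _).2 (huv.trans ((quantile_le_iff hL hv _).1 le_rfl))

theorem aemeasurable_quantile (hL : AEMeasurable L P) :
    AEMeasurable (quantile P L) (volume.restrict (Ioo (0 : ℝ) 1)) :=
  aemeasurable_restrict_of_monotoneOn measurableSet_Ioo (monotoneOn_quantile hL)

theorem map_quantile (hL : AEMeasurable L P) :
    (volume.restrict (Ioo (0 : ℝ) 1)).map (quantile P L) = P.map L := by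
  have := Measure.isProbabilityMeasure_map hL
  have := Measure.isProbabilityMeasure_map (aemeasurable_quantile hL)
  refine Measure.ext_of_Iic _ _ fun x => ?_
  have hF1 := cdf_le_one (P.map L) x
  rw [Measure.map_apply_of_aemeasurable (aemeasurable_quantile hL) measurableSet_Iic,
    ← ofReal_cdf]
  have hae : (quantile P L ⁻¹' Iic x) =ᵐ[volume.restrict (Ioo (0 : ℝ) 1)]
      Iic (cdf (P.map L) x) := by
    filter_upwards [ae_restrict_mem measurableSet_Ioo] with u hu
    exact propext (quantile_le_iff hL hu x)
  rw [measure_congr hae, ← restrict_Ioc_eq_restrict_Ioo, Measure.restrict_apply measurableSet_Iic,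
    inter_comm, Ioc_inter_Iic, min_eq_right hF1, Real.volume_Ioc, sub_zero]

theorem expect_eq_extIntegral_quantile (hL : AEMeasurable L P) {h : ℝ → ℝ} (hh : Measurable h) :
    expect P h L =
      extIntegral (volume.restrict (Ioo (0 : ℝ) 1)) (fun u => ((h (quantile P L u) : ℝ) : EReal)) := by
  have hm : Measurable fun x => ((h x : ℝ) : EReal) := measurable_coe_real_ereal.comp hh
  rw [← extIntegral_map (aemeasurable_quantile hL) hm, map_quantile hL, extIntegral_map hL hm]
  rfl

theorem exists_abs_quantile_le (hL : MemLp L ⊤ P) :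
    ∃ M, 0 ≤ M ∧ ∀ u ∈ Ioo (0 : ℝ) 1, |quantile P L u| ≤ M := by
  have hm := hL.aestronglyMeasurable.aemeasurable
  have := Measure.isProbabilityMeasure_map hm
  obtain ⟨C, hC⟩ : ∃ C : ℝ, ∀ᵐ ω ∂P, |L ω| ≤ C := by
    refine ⟨(eLpNorm L ⊤ P).toReal, ?_⟩
    have h := ae_le_eLpNormEssSup (f := L) (μ := P)
    filter_upwards [h] with ω hω
    rw [← eLpNorm_exponent_top] at hω
    have := ENNReal.toReal_mono hL.2.ne hω
    simpa using this
  refine ⟨max C 0, le_max_right _ _, fun u hu => abs_le.2 ⟨?_, ?_⟩⟩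
  · refine le_csInf (nonempty_le_cdf _ hu.2) fun x hx => ?_
    by_contra! hxC
    have hx0 : cdf (P.map L) x = 0 := by
      rw [cdf_eq_real, measureReal_def, Measure.map_apply_of_aemeasurable hm measurableSet_Iic]
      have : P (L ⁻¹' Iic x) = 0 := by
        rw [measure_eq_zero_iff_ae_notMem]
        filter_upwards [hC] with ω hω hmem
        have h1 : L ω ≤ x := hmem
        have h2 := (abs_le.1 hω).1
        have h3 := le_max_left C 0
        linarith
      simp [this]
    have : u ≤ cdf (P.map L) x := hx
    linarith [hu.1]
  · rw [quantile_le_iff hm hu]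
    have hx1 : cdf (P.map L) (max C 0) = 1 := by
      rw [cdf_eq_real, measureReal_def, Measure.map_apply_of_aemeasurable hm measurableSet_Iic]
      have : P (L ⁻¹' Iic (max C 0)) = 1 := by
        rw [← measure_univ (μ := P)]
        refine measure_congr (eventuallyEq_univ.2 ?_)
        filter_upwards [hC] with ω hω
        exact (le_abs_self _).trans (hω.trans (le_max_left C 0))
      simp [this]
    rw [hx1]; exact hu.2.le

theorem integrable_quantile_mul (hL : MemLp L ⊤ P) {σ : ℝ → ℝ} (hσ : IsDistortion σ) :
    Integrable (fun u => quantile P L u * σ u) (volume.restrict (Ioo (0 : ℝ) 1)) := by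
  obtain ⟨M, -, hM⟩ := exists_abs_quantile_le hL
  exact hσ.integrable.bdd_mul
    (aemeasurable_quantile hL.aestronglyMeasurable.aemeasurable).aestronglyMeasurable
    (ae_Ioo_of_forall hM)

end Quantile

theorem premium_eq {Ω : Type*} [MeasurableSpace Ω] (P : Measure Ω) (L : Ω → ℝ) (σ : ℝ → ℝ) :
    premium P σ L = ∫ u in Ioo (0 : ℝ) 1, quantile P L u * σ u := by
  rw [premium, intervalIntegral.integral_of_le zero_le_one, restrict_Ioc_eq_restrict_Ioo]

/-! ### Weak duality -/

section Duality

variable {Ω : Type*} [MeasurableSpace Ω] {P : Measure Ω} [IsProbabilityMeasure P] {L : Ω → ℝ}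
  {σ h : ℝ → ℝ}

theorem conjugateIntegral_eq :
    conjugateIntegral h σ =
      extIntegral (volume.restrict (Ioo (0 : ℝ) 1)) (fun p => conjugate h (σ p)) := by
  rw [conjugateIntegral, restrict_Ioc_eq_restrict_Ioo]

theorem neg_le_conjugateIntegral (h σ : ℝ → ℝ) : ((-h 0 : ℝ) : EReal) ≤ conjugateIntegral h σ := by
  have h0 : extIntegral (volume.restrict (Ioo (0 : ℝ) 1)) (fun _ => ((-h 0 : ℝ) : EReal)) =
      ((-h 0 : ℝ) : EReal) := by
    rw [extIntegral_coe (integrable_const _)]; simp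
  rw [conjugateIntegral_eq, ← h0]
  refine extIntegral_mono (ae_of_all _ fun u => ?_)
  simpa using le_conjugate h 0 (σ u)

theorem exists_conjugate_ne_top (hc : conjugateIntegral h σ ≠ ⊤) :
    ∃ y, conjugate h y ≠ ⊤ := by
  by_contra! hy
  refine hc ?_
  rw [conjugateIntegral_eq, extIntegral]
  simp [hy]

/-- Fenchel–Young, integrated. Finiteness of h* at a single point y gives h an affine minorant, so
h(q) is bounded below because q is bounded; this rules out ∞ - ∞. -/
theorem premium_le_objective (hσ : IsDistortion σ) (hL : MemLp L ⊤ P) (hh : Measurable h) :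
    (premium P σ L : EReal) ≤ objective P σ L h := by
  have hm := hL.aestronglyMeasurable.aemeasurable
  unfold objective
  by_cases hc : conjugateIntegral h σ = ⊤
  · rw [if_pos hc]; exact le_top
  rw [if_neg hc, expect_eq_extIntegral_quantile hm hh]
  have hbot : conjugateIntegral h σ ≠ ⊥ := fun h' =>
    EReal.coe_ne_bot _ (le_bot_iff.1 (h' ▸ neg_le_conjugateIntegral h σ))
  by_cases hpos : ∫⁻ u in Ioo (0 : ℝ) 1, ENNReal.ofReal (h (quantile P L u)) = ⊤
  · rw [extIntegral_coe_eq_top hpos, EReal.top_add_of_ne_bot hbot]; exact le_top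
  obtain ⟨y, hy⟩ := exists_conjugate_ne_top hc
  obtain ⟨M, hM0, hM⟩ := exists_abs_quantile_le hL
  obtain ⟨c, hyc⟩ : ∃ c : ℝ, conjugate h y ≤ c :=
    ⟨(conjugate h y).toReal, EReal.le_coe_toReal hy⟩
  rw [conjugate_le_iff] at hyc
  have hmeas : AEMeasurable (fun u => h (quantile P L u)) (volume.restrict (Ioo (0 : ℝ) 1)) :=
    hh.comp_aemeasurable (aemeasurable_quantile hm)
  have hint : Integrable (fun u => h (quantile P L u)) (volume.restrict (Ioo (0 : ℝ) 1)) := by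
    have hmax : Integrable (fun u => max (h (quantile P L u)) 0)
        (volume.restrict (Ioo (0 : ℝ) 1)) := by
      refine (lintegral_ofReal_ne_top_iff_integrable
        (hmeas.max (aemeasurable_const (b := (0 : ℝ)))).aestronglyMeasurable
        (ae_of_all _ fun u => le_max_right (h (quantile P L u)) (0 : ℝ))).1 ?_
      simpa using hpos
    refine (hmax.add (integrable_const (M * |y| + |c|))).mono' hmeas.aestronglyMeasurable
      (ae_Ioo_of_forall fun u hu => ?_)
    have h1 := hyc (quantile P L u)
    have h2 : |quantile P L u * y| ≤ M * |y| := by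
      rw [abs_mul]; exact mul_le_mul_of_nonneg_right (hM u hu) (abs_nonneg _)
    have h3 := (abs_le.1 h2).1
    have h4 := le_abs_self c
    have h5 := le_max_left (h (quantile P L u)) 0
    have h6 := le_max_right (h (quantile P L u)) 0
    have h7 : 0 ≤ M * |y| + |c| := by positivity
    simp only [Pi.add_apply]
    rw [Real.norm_eq_abs, abs_le]
    constructor <;> linarith
  have hg : Integrable (fun u => quantile P L u * σ u - h (quantile P L u))
      (volume.restrict (Ioo (0 : ℝ) 1)) := (integrable_quantile_mul hL hσ).sub hint
  have hle : extIntegral (volume.restrict (Ioo (0 : ℝ) 1))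
      (fun u => ((quantile P L u * σ u - h (quantile P L u) : ℝ) : EReal)) ≤
        conjugateIntegral h σ := by
    rw [conjugateIntegral_eq]
    exact extIntegral_mono (ae_of_all _ fun u => le_conjugate h _ _)
  rw [extIntegral_coe hint]
  refine le_trans (le_of_eq ?_) (add_le_add le_rfl hle)
  rw [extIntegral_coe hg, ← EReal.coe_add, integral_sub (integrable_quantile_mul hL hσ) hint,
    premium_eq]
  congr 1; ring

end Duality

/-! ### A superlinear function with small integral -/

theorem exists_integral_max_sub_le {α : Type*} [MeasurableSpace α] {μ : Measure α} {f : α → ℝ}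
    (hf : Integrable f μ) {ε : ENNReal} (hε : ε ≠ 0) (a : ℝ) :
    ∃ c : ℝ, a ≤ c ∧ ∫⁻ x, ENNReal.ofReal (f x - c) ∂μ ≤ ε := by
  have ht : Tendsto (fun n : ℕ => ∫⁻ x, ENNReal.ofReal (f x - n) ∂μ) atTop (𝓝 (∫⁻ _, 0 ∂μ)) := by
    refine tendsto_lintegral_of_dominated_convergence' (fun x => ENNReal.ofReal (f x))
      (fun n => (hf.aemeasurable.sub_const _).ennreal_ofReal)
      (fun n => ae_of_all _ fun x => ENNReal.ofReal_le_ofReal (by simp))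
      hf.lintegral_lt_top.ne (ae_of_all _ fun x => ?_)
    refine tendsto_const_nhds.congr' ?_
    filter_upwards [eventually_ge_atTop ⌈f x⌉₊] with n hn
    have : f x ≤ n := Nat.ceil_le.1 hn
    rw [ENNReal.ofReal_of_nonpos (by linarith)]
  rw [lintegral_zero] at ht
  obtain ⟨n, hn, hna⟩ := ((ht.eventually (gt_mem_nhds (pos_iff_ne_zero.2 hε))).and
    (eventually_ge_atTop ⌈a⌉₊)).exists
  exact ⟨n, Nat.ceil_le.1 hna, hn.le⟩

/-- De la Vallée-Poussin: Θ is a sum of hinges (y - c n)⁺, with thresholds so high that the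
integrals of the hinges at f sum to at most ε. Since c n ≥ n, the sum is finite at each y, while its
slope is unbounded. -/
theorem exists_superlinear {α : Type*} [MeasurableSpace α] {μ : Measure α} {f : α → ℝ}
    (hf : Integrable f μ) {ε : ℝ} (hε : 0 < ε) :
    ∃ Θ : ℝ → ℝ, (∀ y, 0 ≤ Θ y) ∧ (∀ a : ℝ, ∃ b : ℝ, ∀ y, 0 ≤ y → a * y - Θ y ≤ b) ∧
      Integrable (fun x => Θ (f x)) μ ∧ ∫ x, Θ (f x) ∂μ ≤ ε := by
  obtain ⟨δ, hδ, hδε⟩ := ENNReal.exists_pos_sum_of_countable' (ENNReal.ofReal_pos.2 hε).ne' ℕ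
  choose c hcn hc using fun n : ℕ => exists_integral_max_sub_le hf (hδ n).ne' (n : ℝ)
  have hsupp : ∀ y : ℝ, ∀ n ∉ Finset.range ⌈y⌉₊, max (y - c n) 0 = 0 := fun y n hn => by
    have : y ≤ n := Nat.ceil_le.1 (not_lt.1 (fun h => hn (Finset.mem_range.2 h)))
    exact max_eq_right (by linarith [hcn n])
  have hsum : ∀ y : ℝ, Summable fun n => max (y - c n) 0 := fun y =>
    summable_of_ne_finset_zero (hsupp y)
  set Θ : ℝ → ℝ := fun y => ∑' n, max (y - c n) 0 with hΘ
  have hΘ0 : ∀ y, 0 ≤ Θ y := fun y => tsum_nonneg fun n => le_max_right _ _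
  have hmono : Monotone Θ := fun y z hyz =>
    (hsum y).tsum_le_tsum (fun n => max_le_max (by linarith) le_rfl) (hsum z)
  have hofReal : ∀ y, ENNReal.ofReal (Θ y) = ∑' n, ENNReal.ofReal (y - c n) := fun y => by
    rw [hΘ, ENNReal.ofReal_tsum_of_nonneg (fun n => le_max_right _ _) (hsum y)]
    simp
  have hlint : ∫⁻ x, ENNReal.ofReal (Θ (f x)) ∂μ ≤ ENNReal.ofReal ε := by
    simp only [hofReal]
    rw [lintegral_tsum fun n => (hf.aemeasurable.sub_const _).ennreal_ofReal]
    exact (ENNReal.tsum_le_tsum hc).trans hδε.le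
  have hmeas := (hmono.measurable.comp_aemeasurable hf.aemeasurable).aestronglyMeasurable
  refine ⟨Θ, hΘ0, fun a => ?_, ?_, ?_⟩
  -- The first ⌈a⌉ hinges already have total slope at least a; b collects their thresholds.
  · refine ⟨∑ n ∈ Finset.range ⌈a⌉₊, c n, fun y hy => ?_⟩
    have h1 : ∑ n ∈ Finset.range ⌈a⌉₊, (y - c n) ≤ Θ y :=
      (Finset.sum_le_sum fun n _ => le_max_left _ _).trans
        ((hsum y).sum_le_tsum _ fun n _ => le_max_right _ _)
    rw [Finset.sum_sub_distrib, Finset.sum_const, Finset.card_range, nsmul_eq_mul] at h1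
    have h2 := mul_le_mul_of_nonneg_right (Nat.le_ceil a) hy
    linarith
  · exact (lintegral_ofReal_ne_top_iff_integrable hmeas (ae_of_all _ fun x => hΘ0 _)).1
      (hlint.trans_lt ENNReal.ofReal_lt_top).ne
  · rw [integral_eq_lintegral_of_nonneg_ae (ae_of_all _ fun x => hΘ0 _) hmeas]
    exact ENNReal.toReal_le_of_le_ofReal hε.le hlint

/-! ### A nearly optimal convex function -/

/-- For monotone `q` and `s` on `(0, 1)`, the antiderivative of a monotone function through the
points `(s u, q u)` has `q u` as a subgradient at `s u`. -/
theorem exists_subgradient_potential {q s : ℝ → ℝ} {M : ℝ}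
    (hq : MonotoneOn q (Ioo (0 : ℝ) 1)) (hs : MonotoneOn s (Ioo (0 : ℝ) 1))
    (hM0 : 0 ≤ M) (hM : ∀ u ∈ Ioo (0 : ℝ) 1, |q u| ≤ M) :
    ∃ k : ℝ → ℝ, Continuous k ∧ (∀ y, |k y| ≤ M * |y|) ∧
      ∀ u ∈ Ioo (0 : ℝ) 1, ∀ y, q u * y - k y ≤ q u * s u - k (s u) := by
  -- Inserting -M keeps the supremum meaningful, and at least -M, when no s v is below t.
  set S : ℝ → Set ℝ := fun t => insert (-M) (q '' {v | v ∈ Ioo (0 : ℝ) 1 ∧ s v ≤ t}) with hS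
  have hSne : ∀ t, (S t).Nonempty := fun t => ⟨-M, mem_insert _ _⟩
  have hSM : ∀ t, ∀ z ∈ S t, z ≤ M := by
    rintro t z (rfl | ⟨v, hv, rfl⟩)
    · linarith
    · exact (abs_le.1 (hM v hv.1)).2
  have hSb : ∀ t, BddAbove (S t) := fun t => ⟨M, hSM t⟩
  set r : ℝ → ℝ := fun t => sSup (S t) with hr
  have hrmono : Monotone r := fun t t' htt' =>
    csSup_le_csSup (hSb t') (hSne t) (insert_subset_insert (image_mono
      fun v hv => ⟨hv.1, hv.2.trans htt'⟩))
  have hrM : ∀ t, |r t| ≤ M := fun t =>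
    abs_le.2 ⟨le_csSup (hSb t) (mem_insert _ _), csSup_le (hSne t) (hSM t)⟩
  have hint : ∀ a b, IntervalIntegrable r volume a b := fun a b => hrmono.intervalIntegrable
  refine ⟨fun y => ∫ t in (0 : ℝ)..y, r t, intervalIntegral.continuous_primitive hint 0,
    fun y => ?_, fun u hu y => ?_⟩
  · have := intervalIntegral.norm_integral_le_of_norm_le_const (a := 0) (b := y) (f := r) (C := M)
      fun t _ => hrM t
    simpa using this
  · have hsub : (∫ t in (0 : ℝ)..y, r t) - ∫ t in (0 : ℝ)..s u, r t = ∫ t in s u..y, r t :=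
      intervalIntegral.integral_interval_sub_left (hint _ _) (hint _ _)
    suffices q u * (y - s u) ≤ ∫ t in s u..y, r t by linarith
    rcases le_total (s u) y with h | h
    · have := intervalIntegral.integral_mono_on (f := fun _ => q u) h
        intervalIntegrable_const (hint _ _) fun t ht =>
          le_csSup (hSb t) (mem_insert_of_mem _ ⟨u, ⟨hu, ht.1⟩, rfl⟩)
      rw [intervalIntegral.integral_const, smul_eq_mul] at this
      linarith
    · have := intervalIntegral.integral_mono_on_of_le_Ioo (f := r) (g := fun _ => q u) h
        (hint _ _) intervalIntegrable_const fun t ht => by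
          refine csSup_le (hSne t) ?_
          rintro z (rfl | ⟨v, hv, rfl⟩)
          · exact (abs_le.1 (hM u hu)).1
          · refine hq hv.1 hu ?_
            by_contra! huv
            exact absurd (hs hu hv.1 huv.le) (not_le.2 (hv.2.trans_lt ht.2))
      rw [intervalIntegral.integral_const, smul_eq_mul] at this
      rw [intervalIntegral.integral_symm]
      linarith

/-- The supremum of the affine functions `x ↦ x * y - k y`, `y ≥ 0`, is convex. -/
theorem convexOn_iSup_affine {k : ℝ → ℝ}
    (hk : ∀ x, BddAbove (range fun y : Ici (0 : ℝ) => x * y - k y)) :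
    ConvexOn ℝ univ fun x => ⨆ y : Ici (0 : ℝ), (x * y - k y) := by
  refine ⟨convex_univ, fun x _ z _ a b ha hb hab => ciSup_le fun y => ?_⟩
  have h1 := mul_le_mul_of_nonneg_left (le_ciSup (hk x) y) ha
  have h2 := mul_le_mul_of_nonneg_left (le_ciSup (hk z) y) hb
  have h3 : k y = a * k y + b * k y := by rw [← add_mul, hab, one_mul]
  simp only [smul_eq_mul] at *
  linarith

theorem exists_convex_nearly_optimal {Ω : Type*} [MeasurableSpace Ω] {P : Measure Ω}
    [IsProbabilityMeasure P] {L : Ω → ℝ} {σ : ℝ → ℝ} (hσ : IsDistortion σ) (hL : MemLp L ⊤ P)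
    {ε : ℝ} (hε : 0 < ε) :
    ∃ h : ℝ → ℝ, ConvexOn ℝ univ h ∧ Measurable h ∧ conjugateIntegral h σ ≤ 0 ∧
      expect P h L ≤ ((premium P σ L + ε : ℝ) : EReal) := by
  have hm := hL.aestronglyMeasurable.aemeasurable
  obtain ⟨M, hM0, hM⟩ := exists_abs_quantile_le hL
  obtain ⟨k, hkc, hkM, hk⟩ := exists_subgradient_potential (monotoneOn_quantile hm)
    (hσ.mono.mono Ioo_subset_Ico_self) hM0 hM
  obtain ⟨Θ, hΘ0, hΘs, hΘi, hΘε⟩ := exists_superlinear hσ.integrable hε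
  have hki : Integrable (fun u => k (σ u)) (volume.restrict (Ioo (0 : ℝ) 1)) :=
    (hσ.integrable.abs.const_mul M).mono'
      (hkc.measurable.comp_aemeasurable hσ.aemeasurable).aestronglyMeasurable
      (ae_of_all _ fun u => hkM _)
  -- Chosen so that κ ∘ σ has integral 0.
  set c : ℝ := (∫ u in Ioo (0 : ℝ) 1, k (σ u)) + ∫ u in Ioo (0 : ℝ) 1, Θ (σ u) with hcdef
  set κ : ℝ → ℝ := fun y => k y + Θ y - c with hκ
  have hbdd : ∀ x, BddAbove (range fun y : Ici (0 : ℝ) => x * y - κ y) := fun x => by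
    -- For y ≥ 0, -k y ≤ M * y, so Θ has to beat the slope x + M.
    obtain ⟨b, hb⟩ := hΘs (x + M)
    refine ⟨b + c, ?_⟩
    rintro _ ⟨⟨y, hy⟩, rfl⟩
    have h1 := hb y hy
    have h2 := (abs_le.1 (hkM y)).1
    rw [abs_of_nonneg (mem_Ici.1 hy)] at h2
    simp only [hκ]
    linarith
  set h : ℝ → ℝ := fun x => ⨆ y : Ici (0 : ℝ), (x * y - κ y) with hh
  have hconv : ConvexOn ℝ univ h := convexOn_iSup_affine hbdd
  have hmeas : Measurable h := by
    have := hconv.continuousOn isOpen_univ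
    exact (continuousOn_univ.1 this).measurable
  refine ⟨h, hconv, hmeas, ?_, ?_⟩
  · have hκi : Integrable (fun u => κ (σ u)) (volume.restrict (Ioo (0 : ℝ) 1)) :=
      (hki.add hΘi).sub (integrable_const c)
    have hκ0 : ∫ u in Ioo (0 : ℝ) 1, κ (σ u) = 0 := by
      have : ∫ u in Ioo (0 : ℝ) 1, κ (σ u) =
          (∫ u in Ioo (0 : ℝ) 1, (k (σ u) + Θ (σ u))) - ∫ u in Ioo (0 : ℝ) 1, c :=
        integral_sub (hki.add hΘi) (integrable_const c)
      rw [this, integral_add hki hΘi]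
      simp [hcdef]
    have hκe := extIntegral_coe hκi
    rw [hκ0, EReal.coe_zero] at hκe
    rw [conjugateIntegral_eq, ← hκe]
    refine extIntegral_mono (ae_Ioo_of_forall fun u hu => conjugate_le_iff.2 fun x => ?_)
    have := le_ciSup (hbdd x) ⟨σ u, hσ.nonneg_of_mem_Ioo hu⟩
    simp only [hh]
    linarith
  · have hi1 : Integrable (fun u => quantile P L u * σ u - k (σ u))
        (volume.restrict (Ioo (0 : ℝ) 1)) := (integrable_quantile_mul hL hσ).sub hki
    have hi : Integrable (fun u => quantile P L u * σ u - k (σ u) + c)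
        (volume.restrict (Ioo (0 : ℝ) 1)) := hi1.add (integrable_const c)
    have hle : ∀ u ∈ Ioo (0 : ℝ) 1,
        h (quantile P L u) ≤ quantile P L u * σ u - k (σ u) + c := fun u hu => by
      -- The subgradient inequality puts the maximum of the k-part at y = σ u; Θ ≥ 0 is dropped.
      refine ciSup_le fun y => ?_
      have h1 := hk u hu y
      have h2 := hΘ0 y
      simp only [hκ]
      linarith
    rw [expect_eq_extIntegral_quantile hm hmeas]
    refine (extIntegral_mono (ae_Ioo_of_forall fun u hu =>
      EReal.coe_le_coe_iff.2 (hle u hu))).trans ?_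
    rw [extIntegral_coe hi, EReal.coe_le_coe_iff, integral_add hi1 (integrable_const c),
      integral_sub (integrable_quantile_mul hL hσ) hki, premium_eq]
    simp only [integral_const, probReal_univ, smul_eq_mul, one_mul]
    linarith

theorem objective_le_expect {Ω : Type*} [MeasurableSpace Ω] {P : Measure Ω} {L : Ω → ℝ}
    {σ h : ℝ → ℝ} (hc : conjugateIntegral h σ ≤ 0) : objective P σ L h ≤ expect P h L := by
  rw [objective, if_neg (fun h' => absurd (h' ▸ hc) (by simp))]
  simpa using add_le_add (le_refl (expect P h L)) hc

theorem le_coe_of_forall_pos_le_add {a : EReal} {r : ℝ}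
    (h : ∀ ε : ℝ, 0 < ε → a ≤ ((r + ε : ℝ) : EReal)) : a ≤ r := by
  refine EReal.le_of_forall_lt_iff_le.1 fun z hz => ?_
  have hz' : r < z := EReal.coe_lt_coe_iff.1 hz
  simpa using h (z - r) (sub_pos.2 hz')

end DistortedPremium

theorem mainTheorem4 {Ω : Type*} [MeasurableSpace Ω] (P : Measure Ω) [IsProbabilityMeasure P]
    (σ : ℝ → ℝ) (hσ : DistortedPremium.IsDistortion σ)
    (L : Ω → ℝ) (hL : MemLp L ⊤ P) :
    -- the infimum over all measurable functions
    ((DistortedPremium.premium P σ L : EReal) =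
      ⨅ (h : ℝ → ℝ) (_ : Measurable h), DistortedPremium.objective P σ L h) ∧
    -- may be restricted to convex functions,
    ((DistortedPremium.premium P σ L : EReal) =
      ⨅ (h : ℝ → ℝ) (_ : ConvexOn ℝ Set.univ h), DistortedPremium.objective P σ L h) ∧
    -- and may be written with the conjugate integral as a constraint
    ((DistortedPremium.premium P σ L : EReal) =
      ⨅ (h : ℝ → ℝ) (_ : Measurable h) (_ : DistortedPremium.conjugateIntegral h σ ≤ 0),
        DistortedPremium.expect P h L) := by
  have key := fun {ε : ℝ} (hε : 0 < ε) =>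
    DistortedPremium.exists_convex_nearly_optimal hσ hL hε
  refine ⟨le_antisymm ?_ ?_, le_antisymm ?_ ?_, le_antisymm ?_ ?_⟩
  · exact le_iInf₂ fun h hh => DistortedPremium.premium_le_objective hσ hL hh
  · refine DistortedPremium.le_coe_of_forall_pos_le_add fun ε hε => ?_
    obtain ⟨h, -, hm, hc, he⟩ := key hε
    exact (iInf₂_le h hm).trans ((DistortedPremium.objective_le_expect hc).trans he)
  · refine le_iInf₂ fun h hh => DistortedPremium.premium_le_objective hσ hL ?_
    exact (continuousOn_univ.1 (hh.continuousOn isOpen_univ)).measurable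
  · refine DistortedPremium.le_coe_of_forall_pos_le_add fun ε hε => ?_
    obtain ⟨h, hconv, -, hc, he⟩ := key hε
    exact (iInf₂_le h hconv).trans ((DistortedPremium.objective_le_expect hc).trans he)
  · exact le_iInf₂ fun h hh => le_iInf fun hc =>
      (DistortedPremium.premium_le_objective hσ hL hh).trans
        (DistortedPremium.objective_le_expect hc)
  · refine DistortedPremium.le_coe_of_forall_pos_le_add fun ε hε => ?_
    obtain ⟨h, -, hm, hc, he⟩ := key hε
    exact (iInf₂_le h hm).trans ((iInf_le _ hc).trans he)
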